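/- Let $A=(a_{ij})_{i,j\in I}$, $I=\{1,\dots,\ell\}$, be a generalized Cartan matrix: $a_{ij}\in\mathbb Z$, $a_{ii}=2$, $a_{ij}\le 0$ for $i\ne j$, and $a_{ij}=0\iff a_{ji}=0$. Call $A$ symmetrizable if $DA$ is symmetric for some $D=\mathrm{diag}(q_1,\dots,q_\ell)$ with positive rational $q_i$. Say that a generalized Cartan matrix is of finite type if it is symmetrizable with some such $DA$ positive definite, and of affine type if some such $DA$ is symmetric and positive semidefinite but not positive definite. Say that $A$ is hyperbolic if it is neither of finite nor of affine type, every indecomposable submatrix $(a_{ij})_{i,j\in\theta}$ with $\theta\subsetneq I$ is of finite or affine type, and $\det A<0$. (Indecomposable means that the index set has no partition into two non-empty subsets such that $a_{ij}=0$ whenever $i$ lies in the first and $j$ in the second.) Let $\mathfrak h$ be a vector space of dimension $2\ell-\mathrm{rank}(A)$ over a field $K$ of characteristic $0$ (for instance $K=\mathbb C$), with linearly independent simple roots $\alpha_1,\dots,\alpha_\ell\in\mathfrak h^*$ and linearly independent simple coroots $\alpha_1^\vee,\dots,\alpha_\ell^\vee\in\mathfrak h$ such that $\alpha_j(\alpha_i^\vee)=a_{ij}$.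 Let $W\subseteq \mathrm{Aut}(\mathfrak h^*)$ be the Weyl group, generated by the reflections $w_i(\lambda)=\lambda-\lambda(\alpha_i^\vee)\alpha_i$, and let $\Phi=W\{\alpha_1,\dots,\alpha_\ell\}$ be the set of real roots. Let $(\cdot\mid\cdot)$ be a nondegenerate symmetric $W$-invariant bilinear form on $\mathfrak h^*$; the (squared) length of a root $\alpha$ is $(\alpha\mid\alpha)$. Suppose that $A$ is hyperbolic and that either $A$ is symmetric of rank $\ge 4$, or $A$ is symmetrizable of rank $\ge 7$. Then any two real roots $\alpha,\beta\in\Phi$ of the same length, $(\alpha\mid\alpha)=(\beta\mid\beta)$, lie in the same $W$-orbit: there is $w\in W$ with $w\alpha=\beta$. -/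

import Mathlib

namespace KacMoody

/-- A generalized Cartan matrix. -/
structure IsGCM {ι : Type*} (A : Matrix ι ι ℤ) : Prop where
  diag : ∀ i, A i i = 2
  nonpos : ∀ i j, i ≠ j → A i j ≤ 0
  zero_iff : ∀ i j, A i j = 0 ↔ A j i = 0

/-- The real matrix `D A`, where `D` is the diagonal matrix with the rational entries `q`. -/
noncomputable def scaled {ι : Type*} [Fintype ι] [DecidableEq ι]
    (q : ι → ℚ) (A : Matrix ι ι ℤ) : Matrix ι ι ℝ :=
  Matrix.diagonal (fun i => (q i : ℝ)) * A.map (fun a : ℤ => (a : ℝ))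

/-- `A` is symmetrizable: `D A` is symmetric for some positive rational diagonal matrix `D`. -/
def IsSymmetrizable {ι : Type*} [Fintype ι] [DecidableEq ι] (A : Matrix ι ι ℤ) : Prop :=
  ∃ q : ι → ℚ, (∀ i, 0 < q i) ∧ (scaled q A).IsSymm

/-- There is no partition of the index set into two non-empty subsets such that `A i j = 0`
whenever `i` lies in the first and `j` in the second. -/
def IsIndecomposable {ι : Type*} (A : Matrix ι ι ℤ) : Prop :=
  ¬ ∃ s : Set ι, s.Nonempty ∧ sᶜ.Nonempty ∧ ∀ i ∈ s, ∀ j ∈ sᶜ, A i j = 0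

/-- The submatrix `A_θ` with rows and columns in `θ`. -/
def principalSubmatrix {ι : Type*} (A : Matrix ι ι ℤ) (θ : Finset ι) : Matrix θ θ ℤ :=
  A.submatrix (fun i => (i : ι)) (fun i => (i : ι))

/-- Finite type: `A` is positive definite, that is, so is a symmetrization `D A` of it.
(For generalized Cartan matrices this does not depend on the choice of `D`.) -/
def IsFiniteType {ι : Type*} [Fintype ι] [DecidableEq ι] (A : Matrix ι ι ℤ) : Prop :=
  ∃ q : ι → ℚ, (∀ i, 0 < q i) ∧ (scaled q A).PosDef

/-- Affine type: `A` is positive semidefinite but not positive definite, that is, so is a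
symmetrization `D A` of it. -/
def IsAffineType {ι : Type*} [Fintype ι] [DecidableEq ι] (A : Matrix ι ι ℤ) : Prop :=
  ∃ q : ι → ℚ, (∀ i, 0 < q i) ∧ (scaled q A).PosSemidef ∧ ¬ (scaled q A).PosDef

/-- Hyperbolic type: `A` is neither of finite nor of affine type, every proper indecomposable
submatrix is of finite or of affine type, and `det A < 0`. -/
structure IsHyperbolic {ι : Type*} [Fintype ι] [DecidableEq ι] (A : Matrix ι ι ℤ) : Prop where
  not_finite : ¬ IsFiniteType A
  not_affine : ¬ IsAffineType A
  proper : ∀ θ : Finset ι, θ ≠ Finset.univ → IsIndecomposable (principalSubmatrix A θ) →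
    IsFiniteType (principalSubmatrix A θ) ∨ IsAffineType (principalSubmatrix A θ)
  det_neg : A.det < 0

/-- The rank of the integer matrix `A` (over the rationals). -/
noncomputable def rank {ι : Type*} [Fintype ι] (A : Matrix ι ι ℤ) : ℕ :=
  (A.map (fun a : ℤ => (a : ℚ))).rank

/-- A realization of `A` over `K`: a vector space `H` (the Cartan subalgebra) of dimension
`2ℓ - rank A`, where `ℓ` is the size of `A`, with linearly independent simple roots `α_i` in
the dual of `H` and linearly independent simple coroots `α_i^∨` in `H`, such that
`α_j (α_i^∨) = A i j`. -/
structure Realization {ι : Type*} [Fintype ι] (A : Matrix ι ι ℤ)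
    (K : Type*) [Field K] (H : Type*) [AddCommGroup H] [Module K H] where
  finite : Module.Finite K H
  finrank_add_rank : Module.finrank K H + rank A = 2 * Fintype.card ι
  simpleRoot : ι → Module.Dual K H
  simpleCoroot : ι → H
  linearIndependent_simpleRoot : LinearIndependent K simpleRoot
  linearIndependent_simpleCoroot : LinearIndependent K simpleCoroot
  pairing : ∀ i j, simpleRoot j (simpleCoroot i) = (A i j : K)

namespace Realization

variable {ι : Type*} [Fintype ι] {A : Matrix ι ι ℤ} {K : Type*} [Field K]
  {H : Type*} [AddCommGroup H] [Module K H]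

theorem eval_simpleCoroot_self (R : Realization A K H) (hA : IsGCM A) (i : ι) :
    Module.Dual.eval K H (R.simpleCoroot i) (R.simpleRoot i) = 2 := by
  rw [Module.Dual.eval_apply, R.pairing, hA.diag]
  norm_num

/-- The simple reflection `w_i`, as an automorphism of the dual of `H`:
`w_i x = x - x (α_i^∨) α_i`. -/
noncomputable def simpleReflection (R : Realization A K H) (hA : IsGCM A) (i : ι) :
    Module.Dual K H ≃ₗ[K] Module.Dual K H :=
  Module.reflection (R.eval_simpleCoroot_self hA i)

theorem simpleReflection_apply (R : Realization A K H) (hA : IsGCM A) (i : ι)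
    (x : Module.Dual K H) :
    R.simpleReflection hA i x = x - x (R.simpleCoroot i) • R.simpleRoot i := by
  simp [simpleReflection, Module.reflection_apply]

/-- The Weyl group: the group of automorphisms of the dual of `H` generated by the simple
reflections. -/
noncomputable def weylGroup (R : Realization A K H) (hA : IsGCM A) :
    Subgroup (Module.Dual K H ≃ₗ[K] Module.Dual K H) :=
  Subgroup.closure (Set.range (R.simpleReflection hA))

/-- The real roots: the elements that some Weyl group element takes to a simple root. -/
def realRoots (R : Realization A K H) (hA : IsGCM A) : Set (Module.Dual K H) :=
  {x | ∃ w ∈ R.weylGroup hA, ∃ i, w x = R.simpleRoot i}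

/-- `B` is an invariant form on the dual of `H`: a nondegenerate symmetric bilinear form that is
invariant under the Weyl group. The squared length of `x` is `B x x`. -/
structure IsInvariantForm (R : Realization A K H) (hA : IsGCM A)
    (B : LinearMap.BilinForm K (Module.Dual K H)) : Prop where
  nondegenerate : B.Nondegenerate
  symm : B.IsSymm
  invariant : ∀ w ∈ R.weylGroup hA, ∀ x y, B (w x) (w y) = B x y

end Realization

end KacMoody

/-! Every real root is conjugate to a simple root and the form is `W`-invariant, so it suffices to
conjugate two simple roots of equal length. If `A i j = A j i = -1`, then `w_i w_j` takes `α_i` to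
`α_j`; hence a path of such edges is enough.

The tool is `IsHyperbolic.false_of_mulVec_nonpos`: proper subdiagrams are positive semidefinite, so
a nonnegative, nonzero vector that `A` maps to something nonpositive on its support has at most one
zero coordinate. Null vectors of affine diagrams, adapted to the given entries, thus exclude many
subdiagrams. With at least four vertices, an edge with `A i j = A j i` has both entries `-1`. This
settles the symmetric case, since the diagram is connected.

In the other case, adjacent simple roots have equal length exactly when `A i j = A j i`. A diagram
path between roots of equal length therefore cannot contain exactly one length-changing edge. Two
such edges would give a path with multiple first and last edges, which `IsMultiplePath.false` rules
out for at least seven vertices: two vertices off the path contradict the criterion at once; a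
single one is attached somewhere and yields another forbidden subdiagram; if there is none, the
diagram is forced to be affine and `det A = 0`. -/

namespace KacMoody

/-! ### Semidefinite subdiagrams and the vector criterion -/

variable {ι : Type*} {A : Matrix ι ι ℤ}

theorem IsIndecomposable.exists_ne_zero (h : IsIndecomposable A) {s : Set ι} (hs : s.Nonempty)
    (hs' : sᶜ.Nonempty) : ∃ i ∈ s, ∃ j ∈ sᶜ, A i j ≠ 0 := by
  by_contra! h'
  exact h ⟨s, hs, hs', h'⟩

theorem IsGCM.le_neg_one (hA : IsGCM A) {i j : ι} (hij : i ≠ j) (h : A i j ≠ 0) :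
    A i j ≤ -1 := by
  have := hA.nonpos i j hij
  omega

variable [DecidableEq ι]

/-- The symmetrization of the principal submatrix `A_θ`, extended by zero. -/
noncomputable def restricted (q : ι → ℚ) (A : Matrix ι ι ℤ) (θ : Finset ι) : Matrix ι ι ℝ :=
  Matrix.of fun i j => if i ∈ θ ∧ j ∈ θ then (q i : ℝ) * (A i j : ℝ) else 0

/-- Some symmetrization of `A_θ` is positive semidefinite. -/
def IsSemidefiniteOn (A : Matrix ι ι ℤ) (θ : Finset ι) : Prop :=
  ∃ q : ι → ℚ, (∀ i, 0 < q i) ∧ (restricted q A θ).PosSemidef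

theorem IsSemidefiniteOn.union (hA : IsGCM A) {θ₁ θ₂ : Finset ι} (hd : Disjoint θ₁ θ₂)
    (h0 : ∀ i ∈ θ₁, ∀ j ∈ θ₂, A i j = 0) (h₁ : IsSemidefiniteOn A θ₁)
    (h₂ : IsSemidefiniteOn A θ₂) : IsSemidefiniteOn A (θ₁ ∪ θ₂) := by
  obtain ⟨q₁, hq₁, h₁⟩ := h₁
  obtain ⟨q₂, hq₂, h₂⟩ := h₂
  -- There are no entries between the two parts, so their symmetrizers can be glued freely.
  refine ⟨fun i => if i ∈ θ₁ then q₁ i else q₂ i, fun i => ?_, ?_⟩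
  · dsimp only
    split_ifs
    exacts [hq₁ i, hq₂ i]
  · convert h₁.add h₂ using 1
    ext i j
    have hd' : ∀ k, k ∈ θ₁ → k ∉ θ₂ := fun k hk => Finset.disjoint_left.1 hd hk
    have h1 := h0 i
    have h2 : j ∈ θ₁ → i ∈ θ₂ → A i j = 0 := fun hj hi => (hA.zero_iff _ _).1 (h0 j hj i hi)
    have := hd' i
    have := hd' j
    simp only [restricted, Matrix.of_apply, Matrix.add_apply, Finset.mem_union]
    by_cases hi₁ : i ∈ θ₁ <;> by_cases hj₁ : j ∈ θ₁ <;> by_cases hi₂ : i ∈ θ₂ <;>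
      by_cases hj₂ : j ∈ θ₂ <;> simp_all

variable [Fintype ι]

theorem isSemidefiniteOn_of_posSemidef {θ : Finset ι} {q : θ → ℚ} (hq : ∀ i, 0 < q i)
    (h : (scaled q (principalSubmatrix A θ)).PosSemidef) : IsSemidefiniteOn A θ := by
  -- The value `1` off `θ` only keeps `q` positive; `restricted` never sees it.
  refine ⟨fun i => if h : i ∈ θ then q ⟨i, h⟩ else 1, fun i => ?_, ?_⟩
  · dsimp only
    split_ifs
    exacts [hq _, one_pos]
  · let E : Matrix ι θ ℝ := Matrix.of fun i j => if i = j then 1 else 0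
    convert h.mul_mul_conjTranspose_same E using 1
    have hE (f : θ → ℝ) (i : ι) : ∑ k : θ, (if i = k then f k else 0)
        = if h : i ∈ θ then f ⟨i, h⟩ else 0 := by
      split_ifs with hi
      · rw [Finset.sum_eq_single ⟨i, hi⟩]
        · simp
        · intro b _ hb
          rw [if_neg]
          rintro rfl
          exact hb rfl
        · simp
      · refine Finset.sum_eq_zero fun k _ => if_neg ?_
        rintro rfl
        exact hi k.2
    ext i j
    simp only [restricted, Matrix.of_apply, Matrix.mul_apply, Matrix.conjTranspose_apply, E,
      star_trivial, ite_mul, mul_ite, one_mul, zero_mul,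
      mul_one, mul_zero, hE]
    by_cases hi : i ∈ θ <;> by_cases hj : j ∈ θ <;>
      simp [hi, hj, scaled, principalSubmatrix]

/-- Hyperbolicity speaks only of indecomposable subsets; a decomposable one is split and handled by
induction. -/
theorem IsHyperbolic.isSemidefiniteOn (hA : IsGCM A) (hyp : IsHyperbolic A) (θ : Finset ι)
    (hθ : θ ≠ Finset.univ) : IsSemidefiniteOn A θ := by
  classical
  induction θ using Finset.strongInduction with
  | H θ ih =>
    by_cases hind : IsIndecomposable (principalSubmatrix A θ)
    · rcases hyp.proper θ hθ hind with ⟨q, hq, h⟩ | ⟨q, hq, h, -⟩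
      exacts [isSemidefiniteOn_of_posSemidef hq h.posSemidef, isSemidefiniteOn_of_posSemidef hq h]
    · obtain ⟨s, ⟨a, ha⟩, ⟨b, hb⟩, h0⟩ := not_not.1 hind
      have huniv : ∀ θ' ⊆ θ, θ' ≠ Finset.univ := fun θ' h h' =>
        hθ (Finset.univ_subset_iff.1 (h' ▸ h))
      have h1 : θ.filter (fun i => ∃ h : i ∈ θ, (⟨i, h⟩ : θ) ∈ s) ⊂ θ :=
        Finset.filter_ssubset.2 ⟨b, b.2, fun ⟨_, h⟩ => hb h⟩
      have h2 : θ.filter (fun i => ¬ ∃ h : i ∈ θ, (⟨i, h⟩ : θ) ∈ s) ⊂ θ :=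
        Finset.filter_ssubset.2 ⟨a, a.2, fun h => h ⟨a.2, ha⟩⟩
      rw [← Finset.filter_union_filter_not_eq (fun i => ∃ h : i ∈ θ, (⟨i, h⟩ : θ) ∈ s) θ]
      refine (ih _ h1 (huniv _ h1.1)).union hA (Finset.disjoint_filter_filter_not _ _ _) ?_
        (ih _ h2 (huniv _ h2.1))
      intro i hi j hj
      obtain ⟨hi, _, his⟩ := Finset.mem_filter.1 hi
      obtain ⟨hj, hjs⟩ := Finset.mem_filter.1 hj
      exact h0 ⟨i, hi⟩ his ⟨j, hj⟩ fun h => hjs ⟨hj, h⟩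

/-- Otherwise `A` would be a direct sum of two semidefinite proper blocks, hence of finite or affine
type. -/
theorem IsHyperbolic.isIndecomposable (hA : IsGCM A) (hyp : IsHyperbolic A) :
    IsIndecomposable A := by
  classical
  rintro ⟨s, ⟨a, ha⟩, ⟨b, hb⟩, h0⟩
  have h1 : Finset.univ.filter (fun i => i ∈ s) ≠ Finset.univ := fun h =>
    hb (Finset.filter_eq_self.1 h b (Finset.mem_univ _))
  have h2 : Finset.univ.filter (fun i => ¬ i ∈ s) ≠ Finset.univ := fun h =>
    Finset.filter_eq_self.1 h a (Finset.mem_univ _) ha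
  have := (hyp.isSemidefiniteOn hA _ h1).union hA (Finset.disjoint_filter_filter_not _ _ _)
    (fun i hi j hj => h0 i (by simpa using hi) j (by simpa using hj))
    (hyp.isSemidefiniteOn hA _ h2)
  rw [Finset.filter_union_filter_not_eq] at this
  obtain ⟨q, hq, h⟩ := this
  have hs : restricted q A Finset.univ = scaled q A := by
    ext i j
    simp [restricted, scaled]
  rw [hs] at h
  by_cases hp : (scaled q A).PosDef
  · exact hyp.not_finite ⟨q, hq, hp⟩
  · exact hyp.not_affine ⟨q, hq, h, hp⟩

/-- Deleting `w` leaves a semidefinite form, whose value at `x` is the sum of the `q i * x i * (A x)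
i`, hence nonpositive. So `x` lies in its kernel, and the rows other than `w` are unaffected by the
deletion because `x w = 0`. -/
theorem IsHyperbolic.mulVec_eq_zero (hA : IsGCM A) (hyp : IsHyperbolic A) {x : ι → ℤ}
    (hx : ∀ i, 0 ≤ x i) (hrow : ∀ i, 0 < x i → (A.mulVec x) i ≤ 0) {w : ι} (hw : x w = 0)
    {u : ι} (hu : u ≠ w) : (A.mulVec x) u = 0 := by
  obtain ⟨q, hq, h⟩ := hyp.isSemidefiniteOn hA (Finset.univ.erase w)
    (fun h => by simpa using h.ge (Finset.mem_univ w))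
  let y : ι → ℝ := fun i => x i
  have key : ∀ i, i ≠ w → ((restricted q A (Finset.univ.erase w)).mulVec y) i
      = (q i : ℝ) * ((A.mulVec x) i : ℤ) := by
    intro i hi
    simp only [Matrix.mulVec, dotProduct, restricted, Matrix.of_apply, Int.cast_sum, Int.cast_mul,
      Finset.mul_sum, y]
    refine Finset.sum_congr rfl fun j _ => ?_
    by_cases hj : j = w
    · simp [hj, hw]
    · simp [hi, hj, mul_assoc]
  have hle : star y ⬝ᵥ ((restricted q A (Finset.univ.erase w)).mulVec y) ≤ 0 := by
    refine Finset.sum_nonpos fun i _ => ?_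
    by_cases hi : i = w
    · simp [y, hi, hw]
    · rw [key i hi]
      rcases (hx i).eq_or_lt with h0 | h0
      · simp [y, ← h0]
      · have h1 : ((A.mulVec x) i : ℝ) ≤ 0 := by exact_mod_cast hrow i h0
        have h2 : (0 : ℝ) < x i := by exact_mod_cast h0
        have h3 : (0 : ℝ) < q i := by exact_mod_cast hq i
        exact mul_nonpos_of_nonneg_of_nonpos h2.le (mul_nonpos_of_nonneg_of_nonpos h3.le h1)
  have hz := (h.dotProduct_mulVec_zero_iff y).1 (le_antisymm hle (h.dotProduct_mulVec_nonneg y))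
  have := key u hu
  rw [hz] at this
  have h3 : (q u : ℝ) ≠ 0 := by exact_mod_cast (hq u).ne'
  have h4 := (mul_eq_zero.1 this.symm).resolve_left h3
  exact_mod_cast h4

theorem IsGCM.mulVec_le (hA : IsGCM A) {x : ι → ℤ} (hx : ∀ i, 0 ≤ x i) {i : ι} {s : Finset ι}
    (hi : i ∈ s) : (A.mulVec x) i ≤ ∑ j ∈ s, A i j * x j := by
  have : (A.mulVec x) i = ∑ j, A i j * x j := rfl
  rw [this, ← Finset.sum_add_sum_compl s]
  have : ∑ j ∈ sᶜ, A i j * x j ≤ 0 := Finset.sum_nonpos fun j hj =>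
    mul_nonpos_of_nonpos_of_nonneg
      (hA.nonpos _ _ fun h => Finset.mem_compl.1 hj (h ▸ hi)) (hx j)
  linarith

theorem IsGCM.mulVec_le_two (hA : IsGCM A) {x : ι → ℤ} (hx : ∀ i, 0 ≤ x i) {i j : ι}
    (hij : i ≠ j) : (A.mulVec x) i ≤ 2 * x i + A i j * x j := by
  have := hA.mulVec_le hx (i := i) (s := {i, j}) (by simp)
  rwa [Finset.sum_pair hij, hA.diag] at this

theorem IsGCM.mulVec_le_three (hA : IsGCM A) {x : ι → ℤ} (hx : ∀ i, 0 ≤ x i) {i j k : ι}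
    (hij : i ≠ j) (hik : i ≠ k) (hjk : j ≠ k) :
    (A.mulVec x) i ≤ 2 * x i + A i j * x j + A i k * x k := by
  have := hA.mulVec_le hx (i := i) (s := {i, j, k}) (by simp)
  rw [Finset.sum_insert (by simp [hij, hik]), Finset.sum_pair hjk, hA.diag] at this
  linarith

theorem IsGCM.mulVec_le_four (hA : IsGCM A) {x : ι → ℤ} (hx : ∀ i, 0 ≤ x i) {i j k l : ι}
    (hij : i ≠ j) (hik : i ≠ k) (hil : i ≠ l) (hjk : j ≠ k) (hjl : j ≠ l) (hkl : k ≠ l) :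
    (A.mulVec x) i ≤ 2 * x i + A i j * x j + A i k * x k + A i l * x l := by
  have := hA.mulVec_le hx (i := i) (s := {i, j, k, l}) (by simp)
  rw [Finset.sum_insert (by simp [hij, hik, hil]), Finset.sum_insert (by simp [hjk, hjl]),
    Finset.sum_pair hkl, hA.diag] at this
  linarith

/-- A nonzero nonnegative vector with at least two zero coordinates cannot be mapped by `A` to a
vector which is nonpositive on its support. -/
theorem IsHyperbolic.false_of_mulVec_nonpos (hA : IsGCM A) (hyp : IsHyperbolic A) {x : ι → ℤ}
    (hx : ∀ i, 0 ≤ x i) {p : ι} (hp : 0 < x p) (hrow : ∀ i, 0 < x i → (A.mulVec x) i ≤ 0)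
    {u w : ι} (huw : u ≠ w) (hu : x u = 0) (hw : x w = 0) : False := by
  -- An edge leaves the support, so `(A x) j < 0` at its outer end `j`. Yet this coordinate
  -- vanishes: of the two zeros `u` and `w`, one differs from `j` and can be deleted.
  obtain ⟨i, hi, j, hj, hij⟩ := (hyp.isIndecomposable hA).exists_ne_zero (s := {i | 0 < x i})
    ⟨p, hp⟩ ⟨u, by simp [hu]⟩
  simp only [Set.mem_compl_iff, Set.mem_ofPred_eq] at hi hj
  have hj0 : x j = 0 := by have := hx j; omega
  have hne : j ≠ i := by rintro rfl; omega
  have hji : A j i ≤ -1 := hA.le_neg_one hne fun h => hij ((hA.zero_iff _ _).1 h)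
  have hlt := hA.mulVec_le_two hx hne
  have : (A.mulVec x) j = 0 := by
    by_cases h : j = w
    · exact hyp.mulVec_eq_zero hA hx hrow hu (by rw [h]; exact huw.symm)
    · exact hyp.mulVec_eq_zero hA hx hrow hw h
  nlinarith

end KacMoody

/-! ### Paths with multiple end edges: forbidden extensions -/

namespace KacMoody

variable {ι : Type*} {A : Matrix ι ι ℤ}

theorem IsGCM.mul_pos (hA : IsGCM A) {i j : ι} (hij : i ≠ j) (h : A i j ≠ 0) :
    1 ≤ A i j * A j i := by
  have h1 := hA.le_neg_one hij h
  have h2 := hA.le_neg_one hij.symm fun h' => h ((hA.zero_iff _ _).1 h')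
  nlinarith

theorem exists_vector {v : ℕ → ι} {n : ℕ} (hv : Set.InjOn v (Set.Iic n)) {c : ℕ → ℤ}
    (hc : ∀ t ≤ n, 0 ≤ c t) :
    ∃ x : ι → ℤ, (∀ i, 0 ≤ x i) ∧ (∀ t ≤ n, x (v t) = c t) ∧
      ∀ i, (∀ t ≤ n, v t ≠ i) → x i = 0 := by
  classical
  have h1 : ∀ t ≤ n, Function.extend (fun t : Set.Iic n => v t) (fun t => c t) 0 (v t) = c t :=
    fun t ht => (Set.injOn_iff_injective.1 hv).extend_apply (fun t : Set.Iic n => c t) 0 ⟨t, ht⟩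
  have h2 : ∀ i, (∀ t ≤ n, v t ≠ i) →
      Function.extend (fun t : Set.Iic n => v t) (fun t => c t) 0 i = 0 :=
    fun i hi => Function.extend_apply' _ _ _ fun ⟨t, ht⟩ => hi t t.2 ht
  refine ⟨_, fun i => ?_, h1, h2⟩
  by_cases h : ∃ t ≤ n, v t = i
  · obtain ⟨t, ht, rfl⟩ := h
    rw [h1 t ht]
    exact hc t ht
  · push Not at h
    exact (h2 i h).ge

/-- The sequence `u, v 0, v 1, …`. -/
def prepend (u : ι) (v : ℕ → ι) : ℕ → ι
  | 0 => u
  | t + 1 => v t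

/-- A path `v 0, …, v n` in the Dynkin diagram whose first and last edges are multiple. -/
structure IsMultiplePath (A : Matrix ι ι ℤ) (v : ℕ → ι) (n : ℕ) : Prop where
  two_le : 2 ≤ n
  injOn : Set.InjOn v (Set.Iic n)
  adj : ∀ t < n, A (v t) (v (t + 1)) ≠ 0
  first : 2 ≤ A (v 0) (v 1) * A (v 1) (v 0)
  last : 2 ≤ A (v n) (v (n - 1)) * A (v (n - 1)) (v n)

namespace IsMultiplePath

variable {v : ℕ → ι} {n : ℕ}

theorem ne (h : IsMultiplePath A v n) {s t : ℕ} (hs : s ≤ n) (ht : t ≤ n) (hst : s ≠ t) :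
    v s ≠ v t := fun h' => hst (h.injOn hs ht h')

theorem le_neg_one (h : IsMultiplePath A v n) (hA : IsGCM A) {t : ℕ} (ht : t < n) :
    A (v t) (v (t + 1)) ≤ -1 :=
  hA.le_neg_one (h.ne (by omega) (by omega) (by omega)) (h.adj t ht)

theorem le_neg_one' (h : IsMultiplePath A v n) (hA : IsGCM A) {t : ℕ} (ht : t < n) :
    A (v (t + 1)) (v t) ≤ -1 :=
  hA.le_neg_one (h.ne (by omega) (by omega) (by omega))
    fun h' => h.adj t ht ((hA.zero_iff _ _).1 h')

theorem injOn_prepend (h : IsMultiplePath A v n) {m : ℕ} (hm : m ≤ n) {u : ι}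
    (hu : ∀ t ≤ n, v t ≠ u) : Set.InjOn (prepend u v) (Set.Iic (m + 1)) := by
  intro s hs t ht hst
  have hs' := Set.mem_Iic.1 hs
  have ht' := Set.mem_Iic.1 ht
  rcases s with - | s <;> rcases t with - | t
  · rfl
  · exact absurd hst.symm (hu t (by omega))
  · exact absurd hst (hu s (by omega))
  · rw [h.injOn (Set.mem_Iic.2 (by omega)) (Set.mem_Iic.2 (by omega)) hst]

theorem reverse (h : IsMultiplePath A v n) (hA : IsGCM A) :
    IsMultiplePath A (fun t => v (n - t)) n where
  two_le := h.two_le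
  injOn := by
    intro s hs t ht hst
    have hs' : s ≤ n := hs
    have ht' : t ≤ n := ht
    have := h.injOn (Set.mem_Iic.2 (Nat.sub_le n s)) (Set.mem_Iic.2 (Nat.sub_le n t)) hst
    omega
  adj := by
    intro t ht h0
    have := h.adj (n - (t + 1)) (by omega)
    rw [show n - (t + 1) + 1 = n - t by omega] at this
    exact this ((hA.zero_iff _ _).1 h0)
  first := h.last
  last := by
    have := h.two_le
    simpa [Nat.sub_sub_self (show 1 ≤ n by omega)] using h.first

variable [Fintype ι] [DecidableEq ι]

/-- The vector below is the null vector of the affine diagram formed by a path with two double end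
edges; larger products or extra edges only decrease its image. -/
theorem false_of_two_notMem (h : IsMultiplePath A v n) (hA : IsGCM A) (hyp : IsHyperbolic A)
    {u w : ι} (huw : u ≠ w) (hu : ∀ t ≤ n, v t ≠ u) (hw : ∀ t ≤ n, v t ≠ w) : False := by
  have hn := h.two_le
  obtain ⟨m, rfl⟩ : ∃ m, n = m + 2 := ⟨n - 2, by omega⟩
  have hab := h.first
  have hab' := h.last
  have ha := h.le_neg_one hA (t := 0) (by omega)
  have ha' := h.le_neg_one' hA (t := m + 1) (by omega)
  simp only [zero_add, show m + 2 - 1 = m + 1 from rfl, show m + 1 + 1 = m + 2 by omega] at *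
  obtain ⟨x, hx, hxv, hx0⟩ := exists_vector h.injOn
    (c := fun t => if t = 0 then -A (v 0) (v 1) else
      if t = m + 2 then -A (v (m + 2)) (v (m + 1)) else 2) (by
        intro t _
        split_ifs <;> omega)
  have x0 := hxv 0 (by omega)
  have xn := hxv (m + 2) le_rfl
  have xi : ∀ t, 1 ≤ t → t ≤ m + 1 → x (v t) = 2 := fun t h1 h2 => by
    rw [hxv t (by omega), if_neg (by omega), if_neg (by omega)]
  simp only [if_true, if_neg (show m + 2 ≠ 0 by omega)] at x0 xn
  refine hyp.false_of_mulVec_nonpos hA hx (p := v 1) (by rw [xi 1] <;> omega) (fun i hi => ?_)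
    huw (hx0 u hu) (hx0 w hw)
  obtain ⟨t, ht, rfl⟩ : ∃ t ≤ m + 2, v t = i := by
    by_contra! h'
    exact hi.ne' (hx0 i h')
  rcases Nat.eq_zero_or_pos t with rfl | ht0
  · have := hA.mulVec_le_two hx (h.ne (s := 0) (t := 1) (by omega) (by omega) (by omega))
    rw [x0, xi 1 (by omega) (by omega)] at this
    linarith
  rcases ht.eq_or_lt with rfl | htn
  · have := hA.mulVec_le_two hx (h.ne (s := m + 2) (t := m + 1) (by omega) (by omega) (by omega))
    rw [xn, xi (m + 1) (by omega) (by omega)] at this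
    linarith
  have h3 := hA.mulVec_le_three hx
    (h.ne (s := t) (t := t - 1) (by omega) (by omega) (by omega))
    (h.ne (s := t) (t := t + 1) (by omega) (by omega) (by omega))
    (h.ne (s := t - 1) (t := t + 1) (by omega) (by omega) (by omega))
  have hl : A (v t) (v (t - 1)) * x (v (t - 1)) ≤ -2 := by
    rcases Nat.lt_or_ge t 2 with h2 | h2
    · obtain rfl : t = 1 := by omega
      rw [show 1 - 1 = 0 from rfl, x0]
      linarith
    · have := h.le_neg_one' hA (t := t - 1) (by omega)
      rw [show t - 1 + 1 = t by omega] at this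
      rw [xi (t - 1) (by omega) (by omega)]
      linarith
  have hr : A (v t) (v (t + 1)) * x (v (t + 1)) ≤ -2 := by
    rcases Nat.lt_or_ge t (m + 1) with h2 | h2
    · have := h.le_neg_one hA (t := t) (by omega)
      rw [xi (t + 1) (by omega) (by omega)]
      linarith
    · obtain rfl : t = m + 1 := by omega
      rw [show m + 1 + 1 = m + 2 from rfl, xn]
      linarith
  rw [xi t (by omega) (by omega)] at h3
  linarith

/-- The diagram extended at an end of a path with multiple first edge. -/
theorem false_of_adj_zero (h : IsMultiplePath A v n) (hA : IsGCM A) (hyp : IsHyperbolic A)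
    (hn : 5 ≤ n) {u : ι} (hu : ∀ t ≤ n, v t ≠ u) (hadj : A (v 0) u ≠ 0) : False := by
  have huv : ∀ t ≤ n, u ≠ v t := fun t ht h' => hu t ht h'.symm
  have hne : ∀ {s t}, s ≤ 5 → t ≤ 5 → s ≠ t → v s ≠ v t := fun hs ht hst =>
    h.ne (by omega) (by omega) hst
  have hcd := hA.mul_pos (hu 0 (by omega)) hadj
  have hc := hA.le_neg_one (huv 0 (by omega)) fun h' => hadj ((hA.zero_iff _ _).1 h')
  have hab := h.first
  have ha := h.le_neg_one hA (t := 0) (by omega)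
  have h12 := h.le_neg_one hA (t := 1) (by omega)
  have h21 := h.le_neg_one' hA (t := 1) (by omega)
  have h23 := h.le_neg_one hA (t := 2) (by omega)
  have h32 := h.le_neg_one' hA (t := 2) (by omega)
  norm_num at ha h12 h21 h23 h32
  -- With minimal edges this is the null vector of `F_4^(1)` or `E_6^(2)`, according to the
  -- direction of the double edge. It leaves `v 4` and `v 5` at zero.
  obtain ⟨x, hx, hxv, hx0⟩ := exists_vector (h.injOn_prepend (m := 3) (by omega) hu)
    (c := fun t => match t with
      | 0 => A u (v 0) * A (v 0) (v 1)
      | 1 => -2 * A (v 0) (v 1)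
      | 2 => 3
      | 3 => 2
      | _ => 1)
    (by
      intro t ht
      interval_cases t <;> simp <;> nlinarith)
  have xu : x u = A u (v 0) * A (v 0) (v 1) := hxv 0 (by omega)
  have x0 : x (v 0) = -2 * A (v 0) (v 1) := hxv 1 (by omega)
  have x1 : x (v 1) = 3 := hxv 2 (by omega)
  have x2 : x (v 2) = 2 := hxv 3 (by omega)
  have x3 : x (v 3) = 1 := hxv 4 (by omega)
  have xz : ∀ s, 4 ≤ s → s ≤ 5 → x (v s) = 0 := fun s h1 h2 => hx0 _ fun t ht => by
    rcases t with - | t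
    · exact huv s (by omega)
    · exact h.ne (by omega) (by omega) (by omega)
  refine hyp.false_of_mulVec_nonpos hA hx (p := v 1) (by omega) (fun i hi => ?_)
    (hne (s := 4) (t := 5) (by omega) (by omega) (by omega)) (xz 4 (by omega) (by omega))
    (xz 5 (by omega) (by omega))
  obtain ⟨t, ht, rfl⟩ : ∃ t ≤ 4, prepend u v t = i := by
    by_contra! h'
    exact hi.ne' (hx0 i h')
  interval_cases t <;> simp only [prepend]
  · have := hA.mulVec_le_two hx (huv 0 (by omega))
    rw [xu, x0] at this
    linarith
  · have := hA.mulVec_le_three hx (hne (s := 0) (t := 1) (by omega) (by omega) (by omega))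
      (hu 0 (by omega)) (hu 1 (by omega))
    rw [xu, x0, x1] at this
    have h' : A (v 0) u * (A u (v 0) * A (v 0) (v 1)) ≤ A (v 0) (v 1) := by nlinarith
    linarith
  · have := hA.mulVec_le_three hx (hne (s := 1) (t := 0) (by omega) (by omega) (by omega))
      (hne (s := 1) (t := 2) (by omega) (by omega) (by omega))
      (hne (s := 0) (t := 2) (by omega) (by omega) (by omega))
    rw [x0, x1, x2] at this
    linarith
  · have := hA.mulVec_le_three hx (hne (s := 2) (t := 1) (by omega) (by omega) (by omega))
      (hne (s := 2) (t := 3) (by omega) (by omega) (by omega))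
      (hne (s := 1) (t := 3) (by omega) (by omega) (by omega))
    rw [x1, x2, x3] at this
    linarith
  · have := hA.mulVec_le_two hx (hne (s := 3) (t := 2) (by omega) (by omega) (by omega))
    rw [x2, x3] at this
    linarith

/-- The diagram extended at an inner vertex of a path with multiple first edge. -/
theorem false_of_adj (h : IsMultiplePath A v n) (hA : IsGCM A) (hyp : IsHyperbolic A)
    {u : ι} (hu : ∀ t ≤ n, v t ≠ u) {t : ℕ} (ht : 1 ≤ t) (htn : t + 3 ≤ n)
    (hadj : A (v t) u ≠ 0) : False := by
  have huv : ∀ t ≤ n, u ≠ v t := fun t ht h' => hu t ht h'.symm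
  have hd := hA.le_neg_one (hu t (by omega)) hadj
  have hc := hA.le_neg_one (huv t (by omega)) fun h' => hadj ((hA.zero_iff _ _).1 h')
  have hab := h.first
  have ha := h.le_neg_one hA (t := 0) (by omega)
  rw [zero_add] at ha
  -- A double edge at one end and a fork at `v t` with tips `u` and `v (t + 1)`: the null vector of
  -- `B_l^(1)` or `A_{2l-1}^(2)` in the minimal case. Indices are shifted by one because `u` comes
  -- first.
  obtain ⟨x, hx, hxv, hx0⟩ := exists_vector (h.injOn_prepend (m := t + 1) (by omega) hu)
    (c := fun s => if s = 0 then 1 else if s = 1 then - A (v 0) (v 1) else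
      if s = t + 2 then 1 else 2)
    (by
      intro t ht
      split_ifs <;> omega)
  have xu : x u = 1 := hxv 0 (by omega)
  have x0 : x (v 0) = - A (v 0) (v 1) := hxv 1 (by omega)
  have xi : ∀ s, 1 ≤ s → s ≤ t → x (v s) = 2 := fun s h1 h2 => by
    have := hxv (s + 1) (by omega)
    rwa [if_neg (by omega), if_neg (by omega), if_neg (by omega)] at this
  have xt : x (v (t + 1)) = 1 := by
    have := hxv (t + 2) (by omega)
    rwa [if_neg (by omega), if_neg (by omega), if_pos rfl] at this
  have xz : ∀ s, t + 2 ≤ s → s ≤ n → x (v s) = 0 := fun s h1 h2 => hx0 _ fun t ht => by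
    rcases t with - | t
    · exact huv s (by omega)
    · exact h.ne (by omega) (by omega) (by omega)
  refine hyp.false_of_mulVec_nonpos hA hx (p := u) (by omega) (fun i hi => ?_)
    (h.ne (s := t + 2) (t := t + 3) (by omega) (by omega) (by omega))
    (xz _ (by omega) (by omega)) (xz _ (by omega) (by omega))
  obtain ⟨s, hs, rfl⟩ : ∃ s ≤ t + 2, prepend u v s = i := by
    by_contra! h'
    exact hi.ne' (hx0 i h')
  rcases s with - | s <;> simp only [prepend]
  · have := hA.mulVec_le_two hx (huv t (by omega))
    rw [xu, xi t ht le_rfl] at this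
    linarith
  rcases Nat.eq_zero_or_pos s with rfl | hs0
  · have := hA.mulVec_le_two hx (h.ne (s := 0) (t := 1) (by omega) (by omega) (by omega))
    rw [x0, xi 1 le_rfl ht] at this
    linarith
  obtain ⟨r, rfl⟩ : ∃ r, s = r + 1 := ⟨s - 1, by omega⟩
  have hl := h.le_neg_one' hA (t := r) (by omega)
  have hr := h.le_neg_one hA (t := r + 1) (by omega)
  by_cases hst : r = t
  · subst hst
    have := hA.mulVec_le_two hx (h.ne (s := r + 1) (t := r) (by omega) (by omega) (by omega))
    rw [xt, xi r ht le_rfl] at this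
    linarith
  have hl' : A (v (r + 1)) (v r) * x (v r) ≤ -2 := by
    rcases Nat.eq_zero_or_pos r with rfl | h2
    · rw [x0]
      simp only [zero_add]
      linarith
    · rw [xi r (by omega) (by omega)]
      linarith
  by_cases hst : r + 1 = t
  · subst hst
    have := hA.mulVec_le_four hx (h.ne (s := r + 1) (t := r) (by omega) (by omega) (by omega))
      (h.ne (s := r + 1) (t := r + 1 + 1) (by omega) (by omega) (by omega)) (hu _ (by omega))
      (h.ne (s := r) (t := r + 1 + 1) (by omega) (by omega) (by omega)) (hu _ (by omega))
      (hu _ (by omega))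
    rw [xu, xi (r + 1) (by omega) (by omega), xt] at this
    linarith
  · have := hA.mulVec_le_three hx (h.ne (s := r + 1) (t := r) (by omega) (by omega) (by omega))
      (h.ne (s := r + 1) (t := r + 1 + 1) (by omega) (by omega) (by omega))
      (h.ne (s := r) (t := r + 1 + 1) (by omega) (by omega) (by omega))
    rw [xi (r + 1) (by omega) (by omega), xi (r + 1 + 1) (by omega) (by omega)] at this
    linarith

end IsMultiplePath

end KacMoody

/-! ### The shape of a path with multiple end edges, and its exclusion -/

namespace KacMoody

variable {ι : Type*} {A : Matrix ι ι ℤ}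

theorem isMultiplePath_four {a b c d : ι} (hab : a ≠ b) (hac : a ≠ c) (had : a ≠ d) (hbc : b ≠ c)
    (hbd : b ≠ d) (hcd : c ≠ d) (h₁ : 2 ≤ A a b * A b a) (h₂ : A b c ≠ 0)
    (h₃ : 2 ≤ A d c * A c d) :
    IsMultiplePath A (prepend a (prepend b (prepend c fun _ => d))) 3 where
  two_le := by omega
  injOn := by
    intro s hs t ht hst
    have hs' := Set.mem_Iic.1 hs
    have ht' := Set.mem_Iic.1 ht
    interval_cases s <;> interval_cases t <;> simp_all [prepend]
  adj := by
    intro t ht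
    interval_cases t <;> simp only [prepend]
    · intro h
      simp [h] at h₁
    · exact h₂
    · intro h
      simp [h] at h₃
  first := h₁
  last := h₃

namespace IsMultiplePath

variable {v : ℕ → ι} {n : ℕ} [Fintype ι] [DecidableEq ι]

/-- A chord closes a cycle, on which the all-ones vector has nonpositive image; `p` and `q` supply
the two zeros. -/
theorem false_of_cycle (h : IsMultiplePath A v n) (hA : IsGCM A) (hyp : IsHyperbolic A)
    {t s : ℕ} (hts : t + 2 ≤ s) (hs : s ≤ n) (hadj : A (v t) (v s) ≠ 0) {p q : ℕ} (hpq : p ≠ q)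
    (hp : p ≤ n) (hq : q ≤ n) (hp' : p < t ∨ s < p) (hq' : q < t ∨ s < q) : False := by
  obtain ⟨x, hx, hxv, hx0⟩ := exists_vector h.injOn
    (c := fun r => if t ≤ r ∧ r ≤ s then 1 else 0) (by
      intro r _
      split_ifs <;> omega)
  have x1 : ∀ r, t ≤ r → r ≤ s → x (v r) = 1 := fun r h1 h2 => by
    rw [hxv r (by omega), if_pos ⟨h1, h2⟩]
  have x0 : ∀ r ≤ n, r < t ∨ s < r → x (v r) = 0 := fun r h1 h2 => by
    rw [hxv r (by omega), if_neg (by omega)]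
  have hts1 := hA.le_neg_one (h.ne (by omega) (by omega) (by omega)) hadj
  have hts2 := hA.le_neg_one (h.ne (by omega) (by omega) (by omega))
    fun h' => hadj ((hA.zero_iff _ _).1 h')
  refine hyp.false_of_mulVec_nonpos hA hx (p := v t) (by rw [x1] <;> omega) (fun i hi => ?_)
    (h.ne hp hq hpq) (x0 _ hp hp') (x0 _ hq hq')
  obtain ⟨r, hr, rfl⟩ : ∃ r ≤ n, v r = i := by
    by_contra! h'
    exact hi.ne' (hx0 i h')
  have hrt : t ≤ r ∧ r ≤ s := by
    by_contra h'
    exact hi.ne' (x0 r hr (by omega))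
  have hne : ∀ {a b}, a ≤ s → b ≤ s → a ≠ b → v a ≠ v b := fun h1 h2 => h.ne (by omega) (by omega)
  rcases hrt.1.eq_or_lt with rfl | hr1
  · have := hA.mulVec_le_three hx (hne (a := t) (b := t + 1) (by omega) (by omega) (by omega))
      (hne (a := t) (b := s) (by omega) (by omega) (by omega))
      (hne (a := t + 1) (b := s) (by omega) (by omega) (by omega))
    rw [x1 t, x1 (t + 1), x1 s] at this <;> try omega
    have := h.le_neg_one hA (t := t) (by omega)
    linarith
  obtain ⟨r, rfl⟩ : ∃ k, r = k + 1 := ⟨r - 1, by omega⟩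
  have hl := h.le_neg_one' hA (t := r) (by omega)
  rcases hrt.2.eq_or_lt with rfl | hr2
  · have := hA.mulVec_le_three hx (hne (a := r + 1) (b := r) (by omega) (by omega) (by omega))
      (hne (a := r + 1) (b := t) (by omega) (by omega) (by omega))
      (hne (a := r) (b := t) (by omega) (by omega) (by omega))
    rw [x1 (r + 1), x1 r, x1 t] at this <;> omega
  · have := hA.mulVec_le_three hx (hne (a := r + 1) (b := r) (by omega) (by omega) (by omega))
      (hne (a := r + 1) (b := r + 1 + 1) (by omega) (by omega) (by omega))
      (hne (a := r) (b := r + 1 + 1) (by omega) (by omega) (by omega))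
    have := h.le_neg_one hA (t := r + 1) (by omega)
    rw [x1 (r + 1), x1 r, x1 (r + 1 + 1)] at * <;> omega

theorem apply_eq_zero_of_add_two_le (h : IsMultiplePath A v n) (hA : IsGCM A)
    (hyp : IsHyperbolic A) (hn : 5 ≤ n) {t s : ℕ} (hts : t + 2 ≤ s) (hs : s ≤ n) :
    A (v t) (v s) = 0 := by
  by_contra hadj
  by_cases hout : s + 2 ≤ n + t
  · rcases Nat.lt_or_ge t 2 with ht | ht
    · rcases Nat.eq_zero_or_pos t with rfl | ht0
      · exact h.false_of_cycle hA hyp hts hs hadj (p := n - 1) (q := n) (by omega) (by omega)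
          (by omega) (by omega) (by omega)
      · exact h.false_of_cycle hA hyp hts hs hadj (p := 0) (q := n) (by omega) (by omega)
          (by omega) (by omega) (by omega)
    · exact h.false_of_cycle hA hyp hts hs hadj (p := 0) (q := 1) (by omega) (by omega)
        (by omega) (by omega) (by omega)
  -- The remaining chords join `{v 0, v 1}` to `{v (n - 1), v n}`. Here `1 - t` and `2 * n - 1 - s`
  -- index the other ends of the two multiple edges, so the chord gives a shorter multiple path,
  -- which misses `v 2` and `v 3`.
  have hne : ∀ {a b}, a ≤ n → b ≤ n → a ≠ b → v a ≠ v b := h.ne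
  have h1 : 2 ≤ A (v (1 - t)) (v t) * A (v t) (v (1 - t)) := by
    obtain rfl | rfl : t = 0 ∨ t = 1 := by omega
    · rw [mul_comm]
      exact h.first
    · exact h.first
  have h2 : 2 ≤ A (v (2 * n - 1 - s)) (v s) * A (v s) (v (2 * n - 1 - s)) := by
    obtain rfl | rfl : s = n ∨ s = n - 1 := by omega
    · rw [mul_comm, show 2 * s - 1 - s = s - 1 by omega]
      exact h.last
    · rw [show 2 * n - 1 - (n - 1) = n by omega]
      exact h.last
  refine (isMultiplePath_four (a := v (1 - t)) (d := v (2 * n - 1 - s)) (hne ?_ ?_ ?_)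
    (hne ?_ ?_ ?_) (hne ?_ ?_ ?_) (hne ?_ ?_ ?_) (hne ?_ ?_ ?_) (hne ?_ ?_ ?_)
    h1 hadj h2).false_of_two_notMem hA hyp (u := v 2) (w := v 3) (hne ?_ ?_ ?_) ?_ ?_
  any_goals omega
  all_goals
    intro r hr
    interval_cases r <;> simp only [prepend] <;> apply hne <;> omega

/-- A multiple inner edge would end a shorter multiple path, missing `v (n - 1)` and `v n`. -/
theorem mul_eq_one_of_le (h : IsMultiplePath A v n) (hA : IsGCM A) (hyp : IsHyperbolic A)
    {t : ℕ} (ht : 1 ≤ t) (htn : t + 3 ≤ n) : A (v t) (v (t + 1)) * A (v (t + 1)) (v t) = 1 := by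
  by_contra hne
  have := hA.mul_pos (h.ne (s := t) (t := t + 1) (by omega) (by omega) (by omega))
    (h.adj t (by omega))
  have h' : IsMultiplePath A v (t + 1) :=
    { two_le := by omega
      injOn := h.injOn.mono (Set.Iic_subset_Iic.2 (by omega))
      adj := fun s hs => h.adj s (by omega)
      first := h.first
      last := by
        rw [Nat.add_sub_cancel, mul_comm]
        omega }
  exact h'.false_of_two_notMem hA hyp
    (h.ne (s := n - 1) (t := n) (by omega) (by omega) (by omega))
    (fun s hs => h.ne (by omega) (by omega) (by omega))
    (fun s hs => h.ne (by omega) (by omega) (by omega))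

theorem mul_eq_one (h : IsMultiplePath A v n) (hA : IsGCM A) (hyp : IsHyperbolic A)
    (hn : 5 ≤ n) {t : ℕ} (ht : 1 ≤ t) (htn : t + 2 ≤ n) :
    A (v t) (v (t + 1)) * A (v (t + 1)) (v t) = 1 := by
  by_cases htn' : t + 3 ≤ n
  · exact h.mul_eq_one_of_le hA hyp ht htn'
  · have := (h.reverse hA).mul_eq_one_of_le hA hyp (t := n - (t + 1)) (by omega) (by omega)
    rwa [show n - (n - (t + 1)) = t + 1 by omega, show n - (n - (t + 1) + 1) = t by omega,
      mul_comm] at this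

/-- A product of at least `3` is excluded by the null vector of `G_2^(1)` or `D_4^(3)` on the first
three vertices. -/
theorem first_eq_two (h : IsMultiplePath A v n) (hA : IsGCM A) (hyp : IsHyperbolic A)
    (hn : 5 ≤ n) : A (v 0) (v 1) * A (v 1) (v 0) = 2 := by
  by_contra hne2
  have hab := h.first
  have hne : ∀ {s t}, s ≤ 5 → t ≤ 5 → s ≠ t → v s ≠ v t := fun hs ht hst =>
    h.ne (by omega) (by omega) hst
  have ha := h.le_neg_one hA (t := 0) (by omega)
  have h12 := h.le_neg_one hA (t := 1) (by omega)
  have h21 := h.le_neg_one' hA (t := 1) (by omega)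
  norm_num at ha h12 h21
  obtain ⟨x, hx, hxv, hx0⟩ := exists_vector (n := 2)
    (h.injOn.mono (Set.Iic_subset_Iic.2 (by omega)))
    (c := fun t => match t with
      | 0 => - A (v 0) (v 1)
      | 1 => 2
      | _ => 1) (by
      intro t ht
      interval_cases t <;> simp
      omega)
  have x0 : x (v 0) = - A (v 0) (v 1) := hxv 0 (by omega)
  have x1 : x (v 1) = 2 := hxv 1 (by omega)
  have x2 : x (v 2) = 1 := hxv 2 (by omega)
  refine hyp.false_of_mulVec_nonpos hA hx (p := v 1) (by omega) (fun i hi => ?_)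
    (hne (s := 3) (t := 4) (by omega) (by omega) (by omega))
    (hx0 _ fun t ht => hne (by omega) (by omega) (by omega))
    (hx0 _ fun t ht => hne (by omega) (by omega) (by omega))
  obtain ⟨t, ht, rfl⟩ : ∃ t ≤ 2, v t = i := by
    by_contra! h'
    exact hi.ne' (hx0 i h')
  interval_cases t
  · have := hA.mulVec_le_two hx (hne (s := 0) (t := 1) (by omega) (by omega) (by omega))
    rw [x0, x1] at this
    linarith
  · have := hA.mulVec_le_three hx (hne (s := 1) (t := 0) (by omega) (by omega) (by omega))
      (hne (s := 1) (t := 2) (by omega) (by omega) (by omega))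
      (hne (s := 0) (t := 2) (by omega) (by omega) (by omega))
    rw [x0, x1, x2] at this
    have h3 : 3 ≤ A (v 0) (v 1) * A (v 1) (v 0) := by omega
    linarith
  · have := hA.mulVec_le_two hx (hne (s := 2) (t := 1) (by omega) (by omega) (by omega))
    rw [x1, x2] at this
    linarith

/-- With no chords, simple inner edges and end products exactly `2`, the inequalities of
`false_of_two_notMem` become equalities: its vector lies in the kernel of `A`, against `det A < 0`.
-/
theorem false_of_forall_mem (h : IsMultiplePath A v n) (hA : IsGCM A) (hyp : IsHyperbolic A)
    (hn : 5 ≤ n) (hmem : ∀ i, ∃ t ≤ n, v t = i) : False := by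
  have hne := @h.ne
  have ha := h.le_neg_one hA (t := 0) (by omega)
  have ha' := h.le_neg_one' hA (t := n - 1) (by omega)
  have hab := h.first_eq_two hA hyp hn
  have hab' := (h.reverse hA).first_eq_two hA hyp hn
  simp only [Nat.sub_zero] at hab'
  have hone : ∀ t, 1 ≤ t → t + 2 ≤ n → A (v t) (v (t + 1)) = -1 ∧ A (v (t + 1)) (v t) = -1 := by
    intro t ht htn
    have h1 := h.mul_eq_one hA hyp hn ht htn
    have h2 := h.le_neg_one hA (t := t) (by omega)
    have h3 := h.le_neg_one' hA (t := t) (by omega)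
    constructor <;> nlinarith
  have hzero : ∀ s ≤ n, ∀ t ≤ n, s + 2 ≤ t ∨ t + 2 ≤ s → A (v s) (v t) = 0 := by
    rintro s hs t ht (hst | hst)
    · exact h.apply_eq_zero_of_add_two_le hA hyp hn hst ht
    · exact (hA.zero_iff _ _).1 (h.apply_eq_zero_of_add_two_le hA hyp hn hst hs)
  rw [zero_add] at ha
  rw [show n - 1 + 1 = n by omega] at ha'
  obtain ⟨x, hx, hxv, -⟩ := exists_vector h.injOn
    (c := fun t => if t = 0 then -A (v 0) (v 1) else
      if t = n then -A (v n) (v (n - 1)) else 2) (by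
        intro t _
        split_ifs <;> omega)
  have x0 : x (v 0) = -A (v 0) (v 1) := hxv 0 (by omega)
  have xn : x (v n) = -A (v n) (v (n - 1)) := by
    rw [hxv n le_rfl, if_neg (by omega), if_pos rfl]
  have xi : ∀ t, 1 ≤ t → t + 1 ≤ n → x (v t) = 2 := fun t h1 h2 => by
    rw [hxv t (by omega), if_neg (by omega), if_neg (by omega)]
  have hsum : ∀ (i : ι) (s : Finset ι), (∀ t ≤ n, v t ∉ s → A i (v t) = 0) →
      (A.mulVec x) i = ∑ j ∈ s, A i j * x j := fun i s hs =>
    (Finset.sum_subset (Finset.subset_univ s) fun j _ hj => by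
      obtain ⟨t, ht, rfl⟩ := hmem j
      exact mul_eq_zero_of_left (hs t ht hj) _).symm
  refine hyp.det_neg.ne (Matrix.exists_mulVec_eq_zero_iff.1 ⟨x, fun h0 => ?_, ?_⟩)
  · have := xi 1 le_rfl (by omega)
    simp [h0] at this
  ext i
  obtain ⟨t, ht, rfl⟩ := hmem i
  rw [Pi.zero_apply]
  rcases Nat.eq_zero_or_pos t with rfl | ht0
  · rw [hsum _ {v 0, v 1}, Finset.sum_pair (hne (by omega) (by omega) (by omega)), hA.diag, x0,
      xi 1 le_rfl (by omega)]
    · ring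
    · intro s hs hs'
      refine hzero _ (by omega) _ hs ?_
      have h0 : s ≠ 0 := by rintro rfl; simp at hs'
      have h1 : s ≠ 1 := by rintro rfl; simp at hs'
      omega
  rcases ht.eq_or_lt with rfl | htn
  · rw [hsum _ {v t, v (t - 1)}, Finset.sum_pair (hne (by omega) (by omega) (by omega)), hA.diag,
      xn, xi (t - 1) (by omega) (by omega)]
    · ring
    · intro s hs hs'
      refine hzero _ (by omega) _ hs ?_
      have h0 : s ≠ t := by rintro rfl; simp at hs'
      have h1 : s ≠ t - 1 := by rintro rfl; simp at hs'
      omega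
  · rw [hsum _ {v t, v (t - 1), v (t + 1)}, Finset.sum_insert,
      Finset.sum_pair (hne (by omega) (by omega) (by omega)), hA.diag, xi t (by omega) (by omega)]
    · have hl : A (v t) (v (t - 1)) * x (v (t - 1)) = -2 := by
        rcases (Nat.succ_le_of_lt ht0).eq_or_lt with rfl | h2
        · norm_num
          rw [x0]
          linarith
        · have := (hone (t - 1) (by omega) (by omega)).2
          rw [show t - 1 + 1 = t by omega] at this
          rw [this, xi (t - 1) (by omega) (by omega)]
          norm_num
      have hr : A (v t) (v (t + 1)) * x (v (t + 1)) = -2 := by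
        rcases Nat.lt_or_ge (t + 1) n with h2 | h2
        · rw [(hone t (by omega) (by omega)).1, xi (t + 1) (by omega) (by omega)]
          norm_num
        · obtain rfl : n = t + 1 := by omega
          rw [xn]
          rw [Nat.add_sub_cancel] at *
          linarith
      linarith
    · simp only [Finset.mem_insert, Finset.mem_singleton, not_or]
      exact ⟨hne (by omega) (by omega) (by omega), hne (by omega) (by omega) (by omega)⟩
    · intro s hs hs'
      refine hzero _ (by omega) _ hs ?_
      have h0 : s ≠ t := by rintro rfl; simp at hs'
      have h1 : s ≠ t - 1 := by rintro rfl; simp at hs'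
      have h2 : s ≠ t + 1 := by rintro rfl; simp at hs'
      omega

protected theorem false (h : IsMultiplePath A v n) (hA : IsGCM A) (hyp : IsHyperbolic A)
    (hcard : 7 ≤ Fintype.card ι) : False := by
  by_cases hmem : ∀ i, ∃ t ≤ n, v t = i
  · refine h.false_of_forall_mem hA hyp ?_ hmem
    have : (Finset.univ : Finset ι) ⊆ (Finset.range (n + 1)).image v := fun i _ => by
      obtain ⟨t, ht, rfl⟩ := hmem i
      exact Finset.mem_image_of_mem v (Finset.mem_range.2 (by omega))
    have := (Finset.card_le_card this).trans Finset.card_image_le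
    rw [Finset.card_univ, Finset.card_range] at this
    omega
  push Not at hmem
  obtain ⟨u, hu⟩ := hmem
  by_cases hout : ∃ w, u ≠ w ∧ ∀ t ≤ n, v t ≠ w
  · obtain ⟨w, huw, hw⟩ := hout
    exact h.false_of_two_notMem hA hyp huw hu hw
  push Not at hout
  have hn : 5 ≤ n := by
    have : (Finset.univ : Finset ι) ⊆ insert u ((Finset.range (n + 1)).image v) := fun i _ => by
      by_cases hi : u = i
      · simp [hi]
      · obtain ⟨t, ht, rfl⟩ := hout i hi
        exact Finset.mem_insert_of_mem
          (Finset.mem_image_of_mem v (Finset.mem_range.2 (by omega)))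
    have h1 := (Finset.card_le_card this).trans (Finset.card_insert_le _ _)
    have h2 := Finset.card_image_le (s := Finset.range (n + 1)) (f := v)
    rw [Finset.card_univ] at h1
    rw [Finset.card_range] at h2
    omega
  obtain ⟨i, rfl, j, hj, hij⟩ := (hyp.isIndecomposable hA).exists_ne_zero (s := {u})
    (Set.singleton_nonempty u) ⟨v 0, by simpa using hu 0 (by omega)⟩
  obtain ⟨t, ht, rfl⟩ := hout j fun h' => hj h'.symm
  have hadj : A (v t) i ≠ 0 := fun h' => hij ((hA.zero_iff _ _).1 h')
  have hu' : ∀ t ≤ n, v (n - t) ≠ i := fun t _ => hu _ (Nat.sub_le n t)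
  have hadj' : A (v (n - (n - t))) i ≠ 0 := by rwa [Nat.sub_sub_self ht]
  rcases Nat.eq_zero_or_pos t with rfl | ht0
  · exact h.false_of_adj_zero hA hyp hn hu hadj
  rcases ht.eq_or_lt with rfl | htn
  · exact (h.reverse hA).false_of_adj_zero hA hyp hn hu' (by simpa using hadj)
  -- Since `5 ≤ n`, an inner vertex has at least three edges of the path on one side of it.
  by_cases ht3 : t + 3 ≤ n
  · exact h.false_of_adj hA hyp hu ht0 ht3 hadj
  · exact (h.reverse hA).false_of_adj hA hyp hu' (t := n - t) (by omega) (by omega) hadj'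

end IsMultiplePath

end KacMoody

/-! ### Equal-length edges of the Dynkin diagram -/

namespace KacMoody

/-- The Dynkin diagram of `A`, as a simple graph. -/
def dynkinGraph {ι : Type*} (A : Matrix ι ι ℤ) : SimpleGraph ι where
  Adj i j := i ≠ j ∧ A i j ≠ 0 ∧ A j i ≠ 0
  symm := ⟨fun _ _ h => ⟨h.1.symm, h.2.2, h.2.1⟩⟩
  loopless := ⟨fun _ h => h.1 rfl⟩

/-- The subgraph of the edges of the Dynkin diagram between simple roots of the same length. -/
def equalLengthGraph {ι : Type*} (A : Matrix ι ι ℤ) : SimpleGraph ι where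
  Adj i j := i ≠ j ∧ A i j ≠ 0 ∧ A i j = A j i
  symm := ⟨fun _ _ h => ⟨h.1.symm, h.2.2 ▸ h.2.1, h.2.2.symm⟩⟩
  loopless := ⟨fun _ h => h.1 rfl⟩

variable {ι : Type*} [Fintype ι] {A : Matrix ι ι ℤ}

section

variable [DecidableEq ι]

theorem IsHyperbolic.reachable (hA : IsGCM A) (hyp : IsHyperbolic A) (i j : ι) :
    (dynkinGraph A).Reachable i j := by
  by_contra hij
  obtain ⟨k, hk, l, hl, hkl⟩ := (hyp.isIndecomposable hA).exists_ne_zero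
    (s := {k | (dynkinGraph A).Reachable i k}) ⟨i, SimpleGraph.Reachable.refl i⟩ ⟨j, hij⟩
  refine hl (SimpleGraph.Reachable.trans hk (SimpleGraph.Adj.reachable ⟨?_, hkl, ?_⟩))
  · rintro rfl
    exact hl hk
  · exact fun h => hkl ((hA.zero_iff _ _).1 h)

theorem IsHyperbolic.eq_neg_one_of_adj (hA : IsGCM A) (hyp : IsHyperbolic A)
    (hcard : 4 ≤ Fintype.card ι) {i j : ι} (hij : (equalLengthGraph A).Adj i j) :
    A i j = -1 ∧ A j i = -1 := by
  obtain ⟨hne, h0, heq⟩ := hij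
  have h1 := hA.le_neg_one hne h0
  by_contra hcon
  have h2 : A i j ≤ -2 := by omega
  -- If both entries are at most `-2`, the vector equal to `1` at `i` and `j` violates the
  -- criterion; four vertices ensure two zeros.
  obtain ⟨u, hu, w, hw, huw⟩ := Finset.one_lt_card.1 (show 1 < (({i, j} : Finset ι)ᶜ).card by
    rw [Finset.card_compl, Finset.card_pair hne]
    omega)
  simp only [Finset.mem_compl, Finset.mem_insert, Finset.mem_singleton, not_or] at hu hw
  let x : ι → ℤ := fun k => if k = i ∨ k = j then 1 else 0
  have hx : ∀ k, 0 ≤ x k := fun k => by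
    dsimp only [x]
    split_ifs <;> omega
  have hxi : x i = 1 := if_pos (Or.inl rfl)
  have hxj : x j = 1 := if_pos (Or.inr rfl)
  refine hyp.false_of_mulVec_nonpos hA hx (p := i) (by omega) (fun k hk => ?_) huw
    (if_neg (by tauto)) (if_neg (by tauto))
  obtain rfl | rfl : k = i ∨ k = j := by
    by_contra h
    exact hk.ne' (if_neg h)
  · have := hA.mulVec_le_two hx hne
    rw [hxi, hxj] at this
    omega
  · have := hA.mulVec_le_two hx hne.symm
    rw [hxi, hxj] at this
    omega

/-- If some function on the vertices changes along every multiple edge and takes equal values at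
`i` and `j`, then `i` and `j` are joined by edges of the equal length graph. -/
theorem IsHyperbolic.reachable_equalLengthGraph (hA : IsGCM A) (hyp : IsHyperbolic A)
    (hcard : 7 ≤ Fintype.card ι) {M : Type*} (f : ι → M)
    (hf : ∀ i j, (dynkinGraph A).Adj i j → (f i = f j ↔ A i j = A j i)) {i j : ι}
    (hij : f i = f j) : (equalLengthGraph A).Reachable i j := by
  obtain ⟨p, hp⟩ := (hyp.reachable hA i j).exists_isPath
  let v := p.getVert
  have hadj : ∀ t < p.length, (dynkinGraph A).Adj (v t) (v (t + 1)) := fun t ht =>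
    p.adj_getVert_succ ht
  have hreach : ∀ a b, a ≤ b → b ≤ p.length →
      (∀ t, a ≤ t → t < b → A (v t) (v (t + 1)) = A (v (t + 1)) (v t)) →
      (equalLengthGraph A).Reachable (v a) (v b) := by
    intro a b hab
    induction b, hab using Nat.le_induction with
    | base => exact fun _ _ => SimpleGraph.Reachable.refl _
    | succ b hab ih =>
      intro hb h
      refine (ih (by omega) fun t h1 h2 => h t h1 (by omega)).trans
        (SimpleGraph.Adj.reachable ⟨(hadj b (by omega)).1, (hadj b (by omega)).2.1,
          h b hab (by omega)⟩)
  have hconst : ∀ a b, a ≤ b → b ≤ p.length →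
      (∀ t, a ≤ t → t < b → A (v t) (v (t + 1)) = A (v (t + 1)) (v t)) → f (v a) = f (v b) := by
    intro a b hab
    induction b, hab using Nat.le_induction with
    | base => exact fun _ _ => rfl
    | succ b hab ih =>
      intro hb h
      exact (ih (by omega) fun t h1 h2 => h t h1 (by omega)).trans
        ((hf _ _ (hadj b (by omega))).2 (h b hab (by omega)))
  have hv0 : v 0 = i := p.getVert_zero
  have hvl : v p.length = j := p.getVert_length
  have hmul : ∀ t < p.length, A (v t) (v (t + 1)) ≠ A (v (t + 1)) (v t) →
      2 ≤ A (v t) (v (t + 1)) * A (v (t + 1)) (v t) := by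
    intro t ht hne
    obtain ⟨h0, h1, h2⟩ := hadj t ht
    have h1' := hA.le_neg_one h0 h1
    have h2' := hA.le_neg_one h0.symm h2
    rcases hne.lt_or_gt with h | h <;> nlinarith
  by_cases hall : ∀ t, 0 ≤ t → t < p.length → A (v t) (v (t + 1)) = A (v (t + 1)) (v t)
  · have := hreach 0 p.length (Nat.zero_le _) le_rfl hall
    rwa [hv0, hvl] at this
  push Not at hall
  obtain ⟨a, -, ha, hane⟩ := hall
  -- Two asymmetric edges cut out a path with multiple end edges. A single one would make `f` change
  -- exactly once, against `f i = f j`.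
  by_cases hex : ∃ b < p.length, a ≠ b ∧ A (v b) (v (b + 1)) ≠ A (v (b + 1)) (v b)
  · exfalso
    have key : ∀ a b, a < b → b < p.length → A (v a) (v (a + 1)) ≠ A (v (a + 1)) (v a) →
        A (v b) (v (b + 1)) ≠ A (v (b + 1)) (v b) → False := by
      intro a b hab hb hane hbne
      have hpath : IsMultiplePath A (fun t => v (a + t)) (b - a + 1) :=
        { two_le := by omega
          injOn := by
            intro s hs t ht hst
            have hs' := Set.mem_Iic.1 hs
            have ht' := Set.mem_Iic.1 ht
            have := hp.getVert_injOn (show a + s ∈ {i | i ≤ p.length} by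
              show a + s ≤ p.length
              omega) (show a + t ∈ {i | i ≤ p.length} by
              show a + t ≤ p.length
              omega) hst
            omega
          adj := fun t ht => (hadj (a + t) (by omega)).2.1
          first := hmul a (by omega) hane
          last := by
            rw [Nat.add_sub_cancel, show a + (b - a + 1) = b + 1 by omega,
              show a + (b - a) = b by omega, mul_comm]
            exact hmul b hb hbne }
      exact hpath.false hA hyp hcard
    obtain ⟨b, hb, hab, hbne⟩ := hex
    rcases hab.lt_or_gt with h | h
    · exact key a b h hb hane hbne
    · exact key b a h ha hbne hane
  · push Not at hex
    have h1 := hconst 0 a (Nat.zero_le _) ha.le fun t _ ht => hex t (by omega) (by omega)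
    have h2 := hconst (a + 1) p.length ha le_rfl fun t ht ht' => hex t (by omega) (by omega)
    rw [hv0] at h1
    rw [hvl] at h2
    exact absurd ((hf _ _ (hadj a ha)).1 (h1.symm.trans (hij.trans h2.symm))) hane

end

/-! ### Conjugating simple roots; lengths under the invariant form -/

namespace Realization

variable {K : Type*} [Field K] {H : Type*} [AddCommGroup H] [Module K H]

theorem simpleReflection_mem (R : Realization A K H) (hA : IsGCM A) (i : ι) :
    R.simpleReflection hA i ∈ R.weylGroup hA :=
  Subgroup.subset_closure ⟨i, rfl⟩

theorem simpleReflection_simpleRoot (R : Realization A K H) (hA : IsGCM A) (i j : ι) :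
    R.simpleReflection hA i (R.simpleRoot j) = R.simpleRoot j - (A i j : K) • R.simpleRoot i := by
  rw [simpleReflection_apply, R.pairing]

theorem exists_weylGroup_of_eq_neg_one (R : Realization A K H) (hA : IsGCM A) {i j : ι}
    (hij : A i j = -1) (hji : A j i = -1) :
    ∃ w ∈ R.weylGroup hA, w (R.simpleRoot i) = R.simpleRoot j := by
  refine ⟨R.simpleReflection hA i * R.simpleReflection hA j,
    mul_mem (R.simpleReflection_mem hA i) (R.simpleReflection_mem hA j), ?_⟩
  rw [LinearEquiv.mul_apply, simpleReflection_simpleRoot, map_sub, map_smul,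
    simpleReflection_simpleRoot, simpleReflection_simpleRoot, hij, hji, hA.diag]
  push_cast
  module

theorem exists_weylGroup_of_reachable [DecidableEq ι] (R : Realization A K H) (hA : IsGCM A)
    (hyp : IsHyperbolic A) (hcard : 4 ≤ Fintype.card ι) {i j : ι}
    (hij : (equalLengthGraph A).Reachable i j) :
    ∃ w ∈ R.weylGroup hA, w (R.simpleRoot i) = R.simpleRoot j := by
  obtain ⟨p⟩ := hij
  induction p with
  | nil => exact ⟨1, one_mem _, rfl⟩
  | cons h _ ih =>
    obtain ⟨w, hw, hwe⟩ := ih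
    obtain ⟨h1, h2⟩ := hyp.eq_neg_one_of_adj hA hcard h
    obtain ⟨w', hw', hwe'⟩ := R.exists_weylGroup_of_eq_neg_one hA h1 h2
    exact ⟨w * w', mul_mem hw hw', by rw [LinearEquiv.mul_apply, hwe', hwe]⟩

variable {R : Realization A K H} {hA : IsGCM A}
  {B : LinearMap.BilinForm K (Module.Dual K H)}

/-- Expand the invariance of `B (α_i, x)` under `w_i`, which negates `α_i`. -/
theorem IsInvariantForm.two_mul_apply (hB : R.IsInvariantForm hA B) (i : ι)
    (x : Module.Dual K H) :
    2 * B (R.simpleRoot i) x = x (R.simpleCoroot i) * B (R.simpleRoot i) (R.simpleRoot i) := by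
  have h := hB.invariant _ (R.simpleReflection_mem hA i) (R.simpleRoot i) x
  rw [simpleReflection_simpleRoot, simpleReflection_apply, hA.diag] at h
  simp only [map_sub, map_smul, LinearMap.sub_apply, LinearMap.smul_apply, smul_eq_mul] at h
  push_cast at h
  linear_combination -h

/-- By the previous identity an isotropic simple root would lie in the radical of `B`. -/
theorem IsInvariantForm.apply_self_ne_zero [CharZero K] (hB : R.IsInvariantForm hA B) (i : ι) :
    B (R.simpleRoot i) (R.simpleRoot i) ≠ 0 := fun h0 => by
  refine R.linearIndependent_simpleRoot.ne_zero i (hB.nondegenerate.1 _ fun x => ?_)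
  have := hB.two_mul_apply i x
  simpa [h0] using this

/-- Both `A i j * (α_i | α_i)` and `A j i * (α_j | α_j)` equal `2 * (α_i | α_j)`. -/
theorem IsInvariantForm.apply_self_eq_iff [CharZero K] (hB : R.IsInvariantForm hA B) {i j : ι}
    (hij : A i j ≠ 0) :
    B (R.simpleRoot i) (R.simpleRoot i) = B (R.simpleRoot j) (R.simpleRoot j) ↔
      A i j = A j i := by
  have h1 := hB.two_mul_apply i (R.simpleRoot j)
  have h2 := hB.two_mul_apply j (R.simpleRoot i)
  rw [R.pairing] at h1 h2
  rw [← hB.symm.eq (R.simpleRoot i) (R.simpleRoot j)] at h2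
  have h3 := h1.symm.trans h2
  constructor
  · intro h
    rw [h] at h3
    exact_mod_cast mul_right_cancel₀ (hB.apply_self_ne_zero j) h3
  · intro h
    rw [← h] at h3
    exact mul_left_cancel₀ (by exact_mod_cast hij) h3

end Realization

theorem rank_le_card (A : Matrix ι ι ℤ) : rank A ≤ Fintype.card ι := Matrix.rank_le_card_width _

end KacMoody

theorem mainTheorem3 {ι : Type*} [Fintype ι] [DecidableEq ι] (A : Matrix ι ι ℤ)
    (hA : KacMoody.IsGCM A) (hyp : KacMoody.IsHyperbolic A)
    (hrank : (A.IsSymm ∧ 4 ≤ KacMoody.rank A) ∨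
      (KacMoody.IsSymmetrizable A ∧ 7 ≤ KacMoody.rank A))
    {K : Type*} [Field K] [CharZero K] {H : Type*} [AddCommGroup H] [Module K H]
    (R : KacMoody.Realization A K H)
    (B : LinearMap.BilinForm K (Module.Dual K H)) (hB : R.IsInvariantForm hA B)
    (α β : Module.Dual K H) (hα : α ∈ R.realRoots hA) (hβ : β ∈ R.realRoots hA)
    (hlength : B α α = B β β) :
    ∃ w ∈ R.weylGroup hA, w α = β := by
  obtain ⟨w₁, hw₁, i, hi⟩ := hα
  obtain ⟨w₂, hw₂, j, hj⟩ := hβ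
  have hcard := KacMoody.rank_le_card A
  have hreach : (KacMoody.equalLengthGraph A).Reachable i j := by
    rcases hrank with ⟨hsymm, -⟩ | ⟨-, h7⟩
    · refine (hyp.reachable hA i j).mono ?_
      exact fun a b h => ⟨h.1, h.2.1, hsymm.apply b a⟩
    · refine hyp.reachable_equalLengthGraph hA (h7.trans hcard)
        (fun k => B (R.simpleRoot k) (R.simpleRoot k))
        (fun a b hab => hB.apply_self_eq_iff hab.2.1) ?_
      rw [← hi, ← hj, hB.invariant _ hw₁, hB.invariant _ hw₂, hlength]
  obtain ⟨w, hw, hwe⟩ := R.exists_weylGroup_of_reachable hA hyp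
    (by rcases hrank with h | h <;> omega) hreach
  refine ⟨w₂⁻¹ * (w * w₁), mul_mem (inv_mem hw₂) (mul_mem hw hw₁), ?_⟩
  rw [LinearEquiv.mul_apply, LinearEquiv.mul_apply, hi, hwe, ← hj]
  exact w₂.symm_apply_apply β
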